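/- Let $q$ be a prime power, let $1\le \ell\le m$ be integers, and let $\mathcal{G}_{\ell,m}$ be the set of $\ell$-dimensional $\mathbb{F}_q$-subspaces of $\mathbb{F}_q^m$. Let $I(\ell,m)$ be the set of integer tuples $1\le\alpha_1<\dots<\alpha_\ell\le m$, ordered by $\alpha\le\beta$ if and only if $\alpha_i\le\beta_i$ for all $i$. For $W\in\mathcal{G}_{\ell,m}$ let $M_W$ be an $\ell\times m$ matrix with row space $W$, and for $I\in I(\ell,m)$ let $\det_I(M_W)$ be its minor on the columns in $I$. For $\alpha\in I(\ell,m)$ put $$\Omega_\alpha=\{W\in\mathcal{G}_{\ell,m} : \det\nolimits_I(M_W)=0 \text{ for all } I\not\le\alpha\},\qquad W_\alpha=\langle e_{\alpha_1},\dots,e_{\alpha_\ell}\rangle ,$$ where $e_1,\dots,e_m$ is the standard basis of $\mathbb{F}_q^m$. For a downward closed set $S\subseteq I(\ell,m)$ put $\Omega_S=\bigcup_{\alpha\in S}\Omega_\alpha$ and $J_S=\{W_\beta:\beta\in S\}$. A line of $\mathcal{G}_{\ell,m}$ is a set $\{V\in\mathcal{G}_{\ell,m}: Z\subseteq V\subseteq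 Z'\}$ with subspaces $Z\subseteq Z'$ of $\mathbb{F}_q^m$, $\dim Z=\ell-1$, $\dim Z'=\ell+1$. Let $\Gamma_{\Omega_S}$ be the bipartite graph whose two vertex classes are the points of $\Omega_S$ and the lines of $\mathcal{G}_{\ell,m}$ contained in $\Omega_S$, with an edge between a point and a line whenever the point lies on the line. The $2$-closure $\mathrm{cl}_{\Gamma_{\Omega_S}}^{2}(T)$ of a set $T$ of points is the set obtained from $T$ by repeatedly choosing a line of the graph that has at least two, but not all, of its points in the current set, and adding all its points, until no such line exists (the result does not depend on the choices). Then, for every downward closed $S\subseteq I(\ell,m)$, $$\mathrm{cl}_{\Gamma_{\Omega_S}}^{2}(J_S)=\Omega_S .$$ In other words, $J_S\subseteq\Omega_S$ is a $2$-forcing set of $\Gamma_{\Omega_S}$: its $2$-closure is the whole point set of the graph. -/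

import Mathlib

namespace SchubertUnion

/-- A bipartite graph `(V₁, V₂, E)` with finite vertex sets `V₁`, `V₂` and edges `E ⊆ V₁ × V₂`. -/
structure BipartiteGraph (P L : Type*) where
  V₁ : Set P
  V₂ : Set L
  E : Set (P × L)
  finite_V₁ : V₁.Finite
  finite_V₂ : V₂.Finite
  E_subset : E ⊆ V₁ ×ˢ V₂

namespace BipartiteGraph

variable {P L : Type*} (G : BipartiteGraph P L)

/-- The neighborhood `N(u) ⊆ V₁` of a vertex `u ∈ V₂`. -/
def nbhd (u : L) : Set P := {v | v ∈ G.V₁ ∧ (v, u) ∈ G.E}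

/-- One pass through the loop of the irreversible `k`-threshold process: some `u ∈ V₂` has at
least `k` neighbors in the current set `Z`, but fewer than `#N(u)` (which is `n'` when `G` is
`n'`-right regular), and `Z` is replaced by `Z ∪ N(u)`. -/
def Step (k : ℕ) (Z Z' : Set P) : Prop :=
  ∃ u ∈ G.V₂, k ≤ (G.nbhd u ∩ Z).ncard ∧ (G.nbhd u ∩ Z).ncard < (G.nbhd u).ncard ∧
    Z' = Z ∪ G.nbhd u

/-- `Z` is a possible output of the irreversible `k`-threshold process started at `S`: it is
reached from `S` by finitely many steps, and no further step is possible. -/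
def IsOutput (k : ℕ) (S Z : Set P) : Prop :=
  Relation.ReflTransGen (G.Step k) S Z ∧ ∀ Z', ¬ G.Step k Z Z'

theorem finite_nbhd (u : L) : (G.nbhd u).Finite :=
  G.finite_V₁.subset fun _ hv => hv.1

theorem exists_isOutput (k : ℕ) (S : Set P) : ∃ Z, G.IsOutput k S Z := by
  induction h : (G.V₁ \ S).ncard using Nat.strong_induction_on generalizing S with
  | _ n ih =>
    by_cases hS : ∃ Z', G.Step k S Z'
    · obtain ⟨Z', hZ'⟩ := hS
      have hlt : (G.V₁ \ Z').ncard < n := by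
        obtain ⟨u, -, -, hu, rfl⟩ := hZ'
        rw [← h]
        refine Set.ncard_lt_ncard ?_ (G.finite_V₁.subset Set.sdiff_subset)
        refine ⟨fun v hv => ⟨hv.1, fun hvS => hv.2 (Or.inl hvS)⟩, fun hsub => ?_⟩
        refine absurd hu (not_lt.2 (Set.ncard_le_ncard (fun v hv => ⟨hv, ?_⟩)
          ((G.finite_nbhd u).subset Set.inter_subset_left)))
        by_contra hvS
        exact (hsub ⟨hv.1, hvS⟩).2 (Or.inr hv)
      obtain ⟨Z, hZ, hfix⟩ := ih _ hlt Z' rfl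
      exact ⟨Z, Relation.ReflTransGen.head hZ' hZ, hfix⟩
    · exact ⟨S, Relation.ReflTransGen.refl, fun Z' hZ' => hS ⟨Z', hZ'⟩⟩

theorem subset_of_isOutput {k : ℕ} {S X Z : Set P} (hX : Relation.ReflTransGen (G.Step k) S X)
    (hSZ : S ⊆ Z) (hZ : ∀ Z', ¬ G.Step k Z Z') : X ⊆ Z := by
  induction hX with
  | refl => exact hSZ
  | tail _ hstep ih =>
    obtain ⟨u, hu, hk, -, rfl⟩ := hstep
    refine Set.union_subset ih ?_
    have hfin := (G.finite_nbhd u).subset (Set.inter_subset_left (t := Z))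
    by_contra hsub
    refine hZ _ ⟨u, hu, hk.trans (Set.ncard_le_ncard (Set.inter_subset_inter_right _ ih) hfin),
      Set.ncard_lt_ncard ⟨Set.inter_subset_left, fun hle => hsub fun v hv => (hle hv).2⟩
        (G.finite_nbhd u), rfl⟩

theorem subset_of_reflTransGen {k : ℕ} {S X : Set P}
    (hX : Relation.ReflTransGen (G.Step k) S X) : S ⊆ X := by
  induction hX with
  | refl => exact subset_rfl
  | tail _ hstep ih =>
    obtain ⟨u, -, -, -, rfl⟩ := hstep
    exact ih.trans Set.subset_union_left

/-- The process terminates, and its output does not depend on the choices made. -/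
theorem existsUnique_isOutput (k : ℕ) (S : Set P) : ∃! Z, G.IsOutput k S Z := by
  obtain ⟨Z, hZ⟩ := G.exists_isOutput k S
  refine ⟨Z, hZ, fun Y hY => Set.Subset.antisymm ?_ ?_⟩
  · exact G.subset_of_isOutput hY.1 (G.subset_of_reflTransGen hZ.1) hZ.2
  · exact G.subset_of_isOutput hZ.1 (G.subset_of_reflTransGen hY.1) hY.2

/-- The `k`-closure of `S` with respect to `G`: the output of the irreversible `k`-threshold
process started at `S`. -/
noncomputable def closure (k : ℕ) (S : Set P) : Set P :=
  (G.existsUnique_isOutput k S).choose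

theorem closure_isOutput (k : ℕ) (S : Set P) : G.IsOutput k S (G.closure k S) :=
  (G.existsUnique_isOutput k S).choose_spec.1

/-- `S ⊆ V₁` is a `k`-forcing set of `G`. -/
def IsForcingSet (k : ℕ) (S : Set P) : Prop := S ⊆ G.V₁ ∧ G.closure k S = G.V₁

end BipartiteGraph

/-- `I(ℓ, m)`: strictly increasing `ℓ`-tuples with entries in an `m`-element chain
(`Fin m` in place of `{1, …, m}`). -/
abbrev Idx (ℓ m : ℕ) : Type := Fin ℓ ↪o Fin m

/-- The Bruhat order: `α ≤ β` if and only if `α_i ≤ β_i` for all `i`. -/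
def BruhatLE {ℓ m : ℕ} (α β : Idx ℓ m) : Prop := ∀ i, α i ≤ β i

/-- `S ⊆ I(ℓ, m)` is downward closed for the Bruhat order. -/
def IsDownwardClosed {ℓ m : ℕ} (S : Set (Idx ℓ m)) : Prop :=
  ∀ α β : Idx ℓ m, BruhatLE α β → β ∈ S → α ∈ S

section Grassmannian

variable (K : Type*) [Field K]

/-- The Grassmannian of `ℓ`-dimensional subspaces of `K^m`. -/
def grassmannian (ℓ m : ℕ) : Set (Submodule K (Fin m → K)) :=
  {W | Module.finrank K W = ℓ}

/-- The set `π_Z^{Z'}` of all `V` in the Grassmannian with `Z ⊆ V ⊆ Z'`. -/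
def pencil (ℓ : ℕ) {m : ℕ} (Z Z' : Submodule K (Fin m → K)) : Set (Submodule K (Fin m → K)) :=
  {V | V ∈ grassmannian K ℓ m ∧ Z ≤ V ∧ V ≤ Z'}

/-- The lines of the Grassmannian: the sets `π_Z^{Z'}` with `Z ⊆ Z'`, `dim Z = ℓ - 1` (there is
none for `ℓ = 0`) and `dim Z' = ℓ + 1`. -/
def lines (ℓ m : ℕ) : Set (Set (Submodule K (Fin m → K))) :=
  {Λ | ∃ Z Z' : Submodule K (Fin m → K), Module.finrank K Z + 1 = ℓ ∧
    Module.finrank K Z' = ℓ + 1 ∧ Z ≤ Z' ∧ Λ = pencil K ℓ Z Z'}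

variable {K}

/-- The row space of a matrix. -/
def rowSpace {ℓ m : ℕ} (M : Matrix (Fin ℓ) (Fin m) K) : Submodule K (Fin m → K) :=
  Submodule.span K (Set.range M.row)

/-- The maximal minor `det_I(M)` on the columns indexed by `I`. -/
def minor {ℓ m : ℕ} (I : Idx ℓ m) (M : Matrix (Fin ℓ) (Fin m) K) : K :=
  (M.submatrix id I).det

variable (K)

/-- The Schubert variety `Ω_α`: all `W` in the Grassmannian with `det_I(M_W) = 0` for all
`I ≰ α`. Here `M_W` is any `ℓ × m` matrix with row space `W`; another choice multiplies all
maximal minors by one common nonzero scalar. -/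
def schubertVariety {ℓ m : ℕ} (α : Idx ℓ m) : Set (Submodule K (Fin m → K)) :=
  {W | W ∈ grassmannian K ℓ m ∧ ∃ M : Matrix (Fin ℓ) (Fin m) K, rowSpace M = W ∧
    ∀ I : Idx ℓ m, ¬ BruhatLE I α → minor I M = 0}

/-- The Schubert union `Ω_S`. -/
def schubertUnion {ℓ m : ℕ} (S : Set (Idx ℓ m)) : Set (Submodule K (Fin m → K)) :=
  ⋃ α ∈ S, schubertVariety K α

/-- `W_α`: the row space of the `ℓ × m` matrix with `(i, α_i)`-th entries `1` and all other
entries `0`. -/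
def coordSubspace {ℓ m : ℕ} (α : Idx ℓ m) : Submodule K (Fin m → K) :=
  rowSpace (Matrix.of fun i j => if j = α i then (1 : K) else 0)

/-- `J_S = {W_β : β ∈ S}`. -/
def apartmentSubset {ℓ m : ℕ} (S : Set (Idx ℓ m)) : Set (Submodule K (Fin m → K)) :=
  {W | ∃ β ∈ S, W = coordSubspace K β}

/-- The point-line incidence graph `Γ_X` of a set `X` of points of the Grassmannian of
`ℓ`-dimensional subspaces of `K^m`, over a finite field `K`: the vertices are the points of `X`
and the lines of the Grassmannian contained in `X`, and the edges are the incidences. -/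
def incidenceGraph [Finite K] (ℓ : ℕ) {m : ℕ} (X : Set (Submodule K (Fin m → K))) :
    BipartiteGraph (Submodule K (Fin m → K)) (Set (Submodule K (Fin m → K))) where
  V₁ := X
  V₂ := {Λ | Λ ∈ lines K ℓ m ∧ Λ ⊆ X}
  E := {p | p.1 ∈ X ∧ (p.2 ∈ lines K ℓ m ∧ p.2 ⊆ X) ∧ p.1 ∈ p.2}
  finite_V₁ := Set.toFinite _
  finite_V₂ := Set.toFinite _
  E_subset := fun _ hp => ⟨hp.1, hp.2.1⟩

end Grassmannian

end SchubertUnion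

namespace SchubertUnion

/-! A subspace lies in `Ω_β` exactly when it has a basis whose `k`-th vector is supported on columns
`≤ β k` (`mem_schubertVariety_iff`). Induct on the number of nonzero entries of such a basis. If
every vector has one nonzero entry, the span is some `W_γ` with `γ ≤ β`, a point of `J_S`. Otherwise
split a vector as `a + b` with smaller supports and let `U` be the span of the others. In the
nondegenerate case `U + ⟨a⟩` and `U + ⟨b⟩` are two points of the line from `U` to `U + ⟨a, b⟩`. That
line stays in `Ω_β` and contains the given subspace (`span_range_mem_of_lineClosed`). -/

/-- Pigeonhole: otherwise `σ` would inject `Iic i` into the smaller set `Iio i`. -/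
theorem exists_le_and_le_perm {ℓ : ℕ} (σ : Equiv.Perm (Fin ℓ)) (i : Fin ℓ) :
    ∃ k ≤ i, i ≤ σ k := by
  by_contra! h
  have := Finset.card_le_card_of_injOn (s := Finset.Iic i) (t := Finset.Iio i) σ
    (fun k hk => by simpa using h k (by simpa using hk)) σ.injective.injOn
  simp at this

theorem exists_idx_comp_perm {ℓ m : ℕ} {f : Fin ℓ → Fin m} (hf : Function.Injective f) :
    ∃ (γ : Idx ℓ m) (σ : Equiv.Perm (Fin ℓ)), ∀ k, γ k = f (σ k) :=
  ⟨OrderEmbedding.ofStrictMono (f ∘ Tuple.sort f) ((Tuple.monotone_sort f).strictMono_of_injective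
    (hf.comp (Tuple.sort f).injective)), Tuple.sort f, fun _ => rfl⟩

theorem bruhatLE_of_comp_perm {ℓ m : ℕ} {α γ : Idx ℓ m} (σ : Equiv.Perm (Fin ℓ))
    (h : ∀ k, γ (σ k) ≤ α k) : BruhatLE γ α := by
  intro i
  obtain ⟨k, hk, hik⟩ := exists_le_and_le_perm σ i
  exact (γ.monotone hik).trans ((h k).trans (α.monotone hk))

variable {K : Type*} [Field K]

/-! ### Schubert conditions and flag-bounded bases -/

/-- The row vectors of `w` lie in the steps of the standard flag selected by `α`. -/
def FlagBounded {ℓ m : ℕ} (α : Idx ℓ m) (w : Fin ℓ → Fin m → K) : Prop :=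
  ∀ k j, α k < j → w k j = 0

/-- Each term of the Leibniz expansion contains a vanishing entry. -/
theorem FlagBounded.minor_eq_zero {ℓ m : ℕ} {α I : Idx ℓ m} {w : Fin ℓ → Fin m → K}
    (hw : FlagBounded α w) (hI : ¬ BruhatLE I α) : minor I (Matrix.of w) = 0 := by
  unfold minor
  rw [← Matrix.det_transpose, Matrix.det_apply]
  refine Finset.sum_eq_zero fun σ _ => ?_
  obtain ⟨k, hk⟩ : ∃ k, α k < I (σ k) := by
    by_contra! h
    exact hI (bruhatLE_of_comp_perm σ h)
  rw [Finset.prod_eq_zero (Finset.mem_univ k), smul_zero]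
  exact hw k _ hk

theorem exists_det_submatrix_ne_zero {ℓ m : ℕ} {M : Matrix (Fin ℓ) (Fin m) K}
    (hM : Module.finrank K (rowSpace M) = ℓ) :
    ∃ f : Fin ℓ → Fin m, (M.submatrix id f).det ≠ 0 := by
  have hr : Module.finrank K (Submodule.span K (Set.range M.col)) = ℓ := by
    rw [← Matrix.rank_eq_finrank_span_cols, Matrix.rank_eq_finrank_span_row]
    exact hM
  obtain ⟨g, hg, -, hli⟩ := Submodule.exists_fun_fin_finrank_span_eq K (Set.range M.col)
  choose f hf using hg
  refine ⟨f ∘ Fin.cast hr.symm, ?_⟩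
  have : LinearIndependent K (M.submatrix id (f ∘ Fin.cast hr.symm)).col := by
    have hcol : (M.submatrix id (f ∘ Fin.cast hr.symm)).col = g ∘ Fin.cast hr.symm := by
      ext k i
      simp [← hf, Matrix.col_apply]
    rw [hcol]
    exact hli.comp _ (Fin.cast_injective _)
  rw [Matrix.linearIndependent_cols_iff_isUnit, Matrix.isUnit_iff_isUnit_det] at this
  exact this.ne_zero

theorem rowSpace_mul_of_isUnit_det {ℓ m : ℕ} {A : Matrix (Fin ℓ) (Fin ℓ) K} (hA : IsUnit A.det)
    (M : Matrix (Fin ℓ) (Fin m) K) : rowSpace (A * M) = rowSpace M := by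
  have key : ∀ (B : Matrix (Fin ℓ) (Fin ℓ) K) (N : Matrix (Fin ℓ) (Fin m) K),
      rowSpace (B * N) ≤ rowSpace N := by
    intro B N
    refine Submodule.span_le.2 ?_
    rintro _ ⟨i, rfl⟩
    have : (B * N).row i = ∑ k, B i k • N.row k := by
      ext j
      simp [Matrix.mul_apply, Matrix.row_apply]
    rw [this]
    exact Submodule.sum_mem _ fun k _ =>
      Submodule.smul_mem _ _ (Submodule.subset_span (Set.mem_range_self k))
  refine (key A M).antisymm ?_
  simpa [← Matrix.mul_assoc, Matrix.nonsing_inv_mul A hA] using key A⁻¹ (A * M)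

theorem det_submatrix_update {ℓ m : ℕ} (N : Matrix (Fin ℓ) (Fin m) K) (f : Fin ℓ → Fin m)
    (hN : N.submatrix id f = 1) (k : Fin ℓ) (j : Fin m) :
    (N.submatrix id (Function.update f k j)).det = N k j := by
  have : N.submatrix id (Function.update f k j) =
      (1 : Matrix (Fin ℓ) (Fin ℓ) K).updateCol k (fun i => N i j) := by
    ext a b
    by_cases h : b = k
    · subst h; simp
    · simp [h, ← hN]
  rw [this, ← Matrix.cramer_apply, Matrix.cramer_one]
  rfl

/-- Normalise `M` to the identity on the columns `f` of a nonzero minor with maximal column sum.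
Each entry of the result is then a minor with one column exchanged, so maximality kills everything
to the right of the pivots. -/
theorem exists_flagBounded_of_mem_schubertVariety {ℓ m : ℕ} {α : Idx ℓ m}
    {W : Submodule K (Fin m → K)} (hW : W ∈ schubertVariety K α) :
    ∃ w : Fin ℓ → Fin m → K, Submodule.span K (Set.range w) = W ∧ FlagBounded α w := by
  obtain ⟨hdim, M, rfl, hmin⟩ := hW
  obtain ⟨f₀, hf₀⟩ := exists_det_submatrix_ne_zero (M := M) hdim
  obtain ⟨f, hf, hmax⟩ := (Set.toFinite {f | (M.submatrix id f).det ≠ 0}).exists_maximalFor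
    (fun f : Fin ℓ → Fin m => ∑ k, (f k : ℕ)) _ ⟨f₀, hf₀⟩
  have hu : IsUnit (M.submatrix id f).det := isUnit_iff_ne_zero.2 hf
  set A := M.submatrix id f with hA
  have hsub : ∀ g : Fin ℓ → Fin m, (A⁻¹ * M).submatrix id g = A⁻¹ * M.submatrix id g := fun g => by
    ext; simp [Matrix.mul_apply]
  have hone : (A⁻¹ * M).submatrix id f = 1 := by
    rw [hsub, ← hA, Matrix.nonsing_inv_mul A hu]
  have hzero : ∀ k j, f k < j → (A⁻¹ * M) k j = 0 := by
    intro k j hkj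
    by_contra hne
    rw [← det_submatrix_update _ f hone, hsub, Matrix.det_mul] at hne
    have hle := hmax (j := Function.update f k j) (right_ne_zero_of_mul hne)
    have hlt : ∑ i, (f i : ℕ) < ∑ i, (Function.update f k j i : ℕ) := by
      refine Finset.sum_lt_sum (fun i _ => ?_) ⟨k, Finset.mem_univ k, by simpa using hkj⟩
      by_cases h : i = k
      · subst h; simpa using hkj.le
      · simp [h]
    exact absurd (hle hlt.le) (not_le.2 hlt)
  have hinj : Function.Injective f := by
    intro a b hab
    by_contra hne
    exact hf (Matrix.det_zero_of_column_eq hne fun i => by simp [hab])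
  -- The pivots need not be increasing in the row index; sorting them gives a nonzero minor, hence
  -- `γ ≤ α`.
  obtain ⟨γ, σ, hγ⟩ := exists_idx_comp_perm hinj
  have hγα : BruhatLE γ α := by
    by_contra h
    have h0 := hmin γ h
    have : M.submatrix id γ = A.submatrix id σ := by
      ext; simp [A, hγ]
    rw [minor, this, Matrix.det_permute'] at h0
    rcases mul_eq_zero.1 h0 with h0 | h0
    · rcases Int.units_eq_one_or (Equiv.Perm.sign σ) with h | h <;> simp [h] at h0
    · exact hf h0
  refine ⟨fun k => (A⁻¹ * M) (σ k), ?_, fun k j hkj => hzero _ _ ?_⟩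
  · rw [← rowSpace_mul_of_isUnit_det (A := A⁻¹) (Matrix.isUnit_nonsing_inv_det A hu) M, rowSpace]
    congr 1
    exact σ.surjective.range_comp ((A⁻¹ * M).row)
  · rw [← hγ]
    exact (hγα k).trans_lt hkj

theorem mem_schubertVariety_iff {ℓ m : ℕ} {α : Idx ℓ m} {W : Submodule K (Fin m → K)} :
    W ∈ schubertVariety K α ↔ Module.finrank K W = ℓ ∧
      ∃ w : Fin ℓ → Fin m → K, Submodule.span K (Set.range w) = W ∧ FlagBounded α w :=
  ⟨fun h => ⟨h.1, exists_flagBounded_of_mem_schubertVariety h⟩, fun ⟨hW, w, hw, hb⟩ =>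
    ⟨hW, Matrix.of w, hw, fun _ hI => hb.minor_eq_zero hI⟩⟩

theorem coordSubspace_eq {ℓ m : ℕ} (β : Idx ℓ m) :
    coordSubspace K β = Submodule.span K (Set.range fun i => Pi.single (β i) (1 : K)) := by
  unfold coordSubspace rowSpace
  congr 2
  ext i j
  simp [Matrix.row_apply, Pi.single_apply]

theorem coordSubspace_mem_schubertVariety {ℓ m : ℕ} (β : Idx ℓ m) :
    coordSubspace K β ∈ schubertVariety K β := by
  refine mem_schubertVariety_iff.2 ⟨?_, _, (coordSubspace_eq β).symm, fun k j h => ?_⟩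
  · rw [coordSubspace_eq, finrank_span_eq_card]
    · simp
    · exact (Pi.linearIndependent_single_one (Fin m) K).comp β β.injective
  · simp [h.ne']

/-! ### Splitting a basis vector along a line -/

theorem span_range_update {ℓ : ℕ} {V : Type*} [AddCommGroup V] [Module K V] (w : Fin ℓ → V)
    (i : Fin ℓ) (v : V) : Submodule.span K (Set.range (Function.update w i v)) =
      Submodule.span K (w '' {i}ᶜ) ⊔ Submodule.span K {v} := by
  rw [← Submodule.span_union]
  congr 1
  ext x
  constructor
  · rintro ⟨k, rfl⟩
    by_cases h : k = i
    · subst h; simp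
    · left; exact ⟨k, h, by simp [h]⟩
  · rintro (⟨k, h, rfl⟩ | rfl)
    · exact ⟨k, by simp [show k ≠ i from h]⟩
    · exact ⟨i, by simp⟩

theorem FlagBounded.update {ℓ m : ℕ} {α : Idx ℓ m} {w : Fin ℓ → Fin m → K}
    (hw : FlagBounded α w) {i : Fin ℓ} {v : Fin m → K} (hv : ∀ j, α i < j → v j = 0) :
    FlagBounded α (Function.update w i v) := by
  intro k j hkj
  by_cases h : k = i
  · subst h; simpa using hv j hkj
  · simpa [h] using hw k j hkj

/-- Each row is a nonzero multiple of one standard vector, with distinct positions by independence;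
sorting the positions keeps them below `β`. -/
theorem coordSubspace_of_support_subsingleton {ℓ m : ℕ} {β : Idx ℓ m} {w : Fin ℓ → Fin m → K}
    (hw : Module.finrank K (Submodule.span K (Set.range w)) = ℓ) (hb : FlagBounded β w)
    (hsupp : ∀ i j j', w i j ≠ 0 → w i j' ≠ 0 → j = j') :
    ∃ γ, BruhatLE γ β ∧ Submodule.span K (Set.range w) = coordSubspace K γ := by
  have hli : LinearIndependent K w := by
    rw [linearIndependent_iff_card_eq_finrank_span, Set.finrank, hw, Fintype.card_fin]
  have hex : ∀ i, ∃ j, w i j ≠ 0 := fun i => Function.ne_iff.1 (hli.ne_zero i)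
  choose f hf using hex
  have hwf : ∀ i, w i = w i (f i) • (Pi.single (f i) 1 : Fin m → K) := by
    intro i
    ext j
    by_cases h : j = f i
    · subst h; simp
    · simp only [Pi.smul_apply, Pi.single_eq_of_ne h, smul_zero]
      by_contra hne
      exact h (hsupp i _ _ hne (hf i))
  have hspan : Submodule.span K (Set.range w) =
      Submodule.span K (Set.range fun i => Pi.single (f i) (1 : K)) := by
    apply le_antisymm <;> rw [Submodule.span_le]
    · rintro _ ⟨i, rfl⟩
      rw [hwf i]
      exact Submodule.smul_mem _ _ (Submodule.subset_span ⟨i, rfl⟩)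
    · rintro _ ⟨i, rfl⟩
      have := Submodule.smul_mem _ (w i (f i))⁻¹
        (Submodule.subset_span (R := K) (Set.mem_range_self (f := w) i))
      rw [hwf i, smul_smul] at this
      simpa [hf i] using this
  have hinj : Function.Injective f := by
    have : LinearIndependent K (fun i => (Pi.single (f i) 1 : Fin m → K)) := by
      rw [linearIndependent_iff_card_eq_finrank_span, Set.finrank, ← hspan, hw, Fintype.card_fin]
    intro a b hab
    exact this.injective (by simp [hab])
  obtain ⟨γ, σ, hγ⟩ := exists_idx_comp_perm hinj
  refine ⟨γ, bruhatLE_of_comp_perm σ.symm fun k => ?_, ?_⟩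
  · rw [hγ, σ.apply_symm_apply]
    by_contra h
    exact hf k (hb k _ (not_le.1 h))
  · rw [hspan, coordSubspace_eq]
    congr 1
    simp only [hγ]
    exact (σ.surjective.range_comp fun i => (Pi.single (f i) 1 : Fin m → K)).symm

/-- A point of the pencil is `U + ⟨v⟩`; dropping the `U`-component of `v` leaves a combination of
`a` and `b`, which obeys the same bound as row `i`. -/
theorem pencil_subset_schubertVariety {ℓ m : ℕ} {β : Idx ℓ m} {w : Fin ℓ → Fin m → K}
    (hb : FlagBounded β w) (i : Fin ℓ) {a b : Fin m → K}
    (hU : Module.finrank K (Submodule.span K (w '' {i}ᶜ)) + 1 = ℓ)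
    (ha : ∀ j, β i < j → a j = 0) (hb' : ∀ j, β i < j → b j = 0) :
    pencil K ℓ (Submodule.span K (w '' {i}ᶜ))
      (Submodule.span K (w '' {i}ᶜ) ⊔ Submodule.span K {a} ⊔ Submodule.span K {b}) ⊆
        schubertVariety K β := by
  rintro V ⟨hV : Module.finrank K V = ℓ, hUV, hVU⟩
  set U := Submodule.span K (w '' {i}ᶜ) with hUdef
  obtain ⟨v, hvV, hvU⟩ : ∃ v ∈ V, v ∉ U := by
    by_contra! h
    have := Submodule.finrank_mono (show V ≤ U from h)
    omega
  obtain ⟨x, hx, y, hy, rfl⟩ := Submodule.mem_sup.1 (hVU hvV)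
  obtain ⟨u, hu, z, hz, rfl⟩ := Submodule.mem_sup.1 hx
  obtain ⟨s, rfl⟩ := Submodule.mem_span_singleton.1 hz
  obtain ⟨t, rfl⟩ := Submodule.mem_span_singleton.1 hy
  have hvU' : s • a + t • b ∉ U := fun h => hvU (by rw [add_assoc]; exact U.add_mem hu h)
  have hvV' : s • a + t • b ∈ V := by
    have := V.sub_mem hvV (hUV hu)
    rwa [add_assoc, add_sub_cancel_left] at this
  refine mem_schubertVariety_iff.2 ⟨hV, Function.update w i (s • a + t • b), ?_,
    hb.update fun j hj => by simp [ha j hj, hb' j hj]⟩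
  rw [span_range_update, ← hUdef]
  refine Submodule.eq_of_le_of_finrank_eq
    (sup_le hUV ((Submodule.span_singleton_le_iff_mem _ _).2 hvV')) ?_
  rw [hV, Submodule.finrank_sup_span_singleton hvU', hU]

theorem span_range_mem_of_lineClosed {ℓ m : ℕ} {S : Set (Idx ℓ m)} (hS : IsDownwardClosed S)
    {Z : Set (Submodule K (Fin m → K))} (hJ : apartmentSubset K S ⊆ Z)
    (hZ : ∀ Λ ∈ lines K ℓ m, Λ ⊆ schubertUnion K S → ∀ A ∈ Λ, A ∈ Z → ∀ B ∈ Λ, B ∈ Z → A ≠ B →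
      Λ ⊆ Z) {β : Idx ℓ m} (hβ : β ∈ S) (w : Fin ℓ → Fin m → K)
    (hw : Module.finrank K (Submodule.span K (Set.range w)) = ℓ) (hb : FlagBounded β w) :
    Submodule.span K (Set.range w) ∈ Z := by
  classical
  induction h : ∑ i, (Finset.univ.filter fun j => w i j ≠ 0).card
    using Nat.strong_induction_on generalizing w with
  | _ n ih =>
  by_cases hsupp : ∀ i j j', w i j ≠ 0 → w i j' ≠ 0 → j = j'
  · obtain ⟨γ, hγ, hspan⟩ := coordSubspace_of_support_subsingleton hw hb hsupp
    exact hJ ⟨γ, hS γ β hγ hβ, hspan⟩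
  push Not at hsupp
  obtain ⟨i, j, j', hj, hj', hne⟩ := hsupp
  have hli : LinearIndependent K w := by
    rw [linearIndependent_iff_card_eq_finrank_span, Set.finrank, hw, Fintype.card_fin]
  have hwU := hli.notMem_span_image (s := {i}ᶜ) (x := i) (by simp)
  have hW := span_range_update (K := K) w i (w i)
  rw [Function.update_eq_self] at hW
  have hU : Module.finrank K (Submodule.span K (w '' {i}ᶜ)) + 1 = ℓ := by
    rw [← Submodule.finrank_sup_span_singleton hwU, ← hW, hw]
  have hind : ∀ v : Fin m → K, v ∉ Submodule.span K (w '' {i}ᶜ) → (∀ k, β i < k → v k = 0) →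
      (Finset.univ.filter fun k => v k ≠ 0).card < (Finset.univ.filter fun k => w i k ≠ 0).card →
      Submodule.span K (w '' {i}ᶜ) ⊔ Submodule.span K {v} ∈ Z := by
    intro v hvU hv hcard
    rw [← span_range_update]
    refine ih _ ?_ (Function.update w i v) ?_ (hb.update hv) rfl
    · rw [← h]
      refine Finset.sum_lt_sum (fun k _ => ?_) ⟨i, Finset.mem_univ i, by simpa using hcard⟩
      by_cases hk : k = i
      · subst hk; simpa using hcard.le
      · simp [hk]
    · rw [span_range_update, Submodule.finrank_sup_span_singleton hvU, hU]
  set U := Submodule.span K (w '' {i}ᶜ) with hUdef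
  have heq : ∀ x y : Fin m → K, x ∉ U → y ∉ U → x ∈ U ⊔ Submodule.span K {y} →
      U ⊔ Submodule.span K {x} = U ⊔ Submodule.span K {y} := by
    intro x y hx hy hxy
    refine Submodule.eq_of_le_of_finrank_eq
      (sup_le le_sup_left ((Submodule.span_singleton_le_iff_mem _ _).2 hxy)) ?_
    rw [Submodule.finrank_sup_span_singleton hx, Submodule.finrank_sup_span_singleton hy]
  have hmem : ∀ x : Fin m → K, x ∈ U ⊔ Submodule.span K {x} := fun x =>
    le_sup_right (a := U) (Submodule.mem_span_singleton_self x)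
  obtain ⟨a, b, hab, ha, hb', hca, hcb⟩ : ∃ a b : Fin m → K, w i = a + b ∧
      (∀ k, β i < k → a k = 0) ∧ (∀ k, β i < k → b k = 0) ∧
      (Finset.univ.filter fun k => a k ≠ 0).card < (Finset.univ.filter fun k => w i k ≠ 0).card ∧
      (Finset.univ.filter fun k => b k ≠ 0).card <
        (Finset.univ.filter fun k => w i k ≠ 0).card := by
    -- Here `a` is the entry at `j` and `b` the rest: `a` loses `j'` and `b` loses `j`, so both
    -- supports shrink.
    refine ⟨Pi.single j (w i j), Function.update (w i) j 0, ?_, fun k hk => ?_, fun k hk => ?_,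
      Finset.card_lt_card (Finset.ssubset_iff_subset_ne.2 ⟨fun k => ?_, fun he => ?_⟩),
      Finset.card_lt_card (Finset.ssubset_iff_subset_ne.2 ⟨fun k => ?_, fun he => ?_⟩)⟩
    · ext k
      by_cases hk : k = j
      · subst hk; simp
      · simp [hk]
    · by_cases hkj : k = j
      · subst hkj; simpa using hb i k hk
      · simp [hkj]
    · by_cases hkj : k = j
      · subst hkj; simp
      · simpa [hkj] using hb i k hk
    · by_cases hk : k = j
      · subst hk; simp
      · simp [hk]
    · have : j' ∈ Finset.univ.filter fun k => w i k ≠ 0 := by simpa using hj'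
      rw [← he] at this
      simp [hne.symm] at this
    · by_cases hk : k = j
      · subst hk; simp
      · simp [hk]
    · have : j ∈ Finset.univ.filter fun k => w i k ≠ 0 := by simpa using hj
      rw [← he] at this
      simp at this
  rw [hW]
  have haddU : w i ∈ U ⊔ Submodule.span K {a} ⊔ Submodule.span K {b} := by
    rw [hab]
    exact Submodule.add_mem_sup (hmem a) (Submodule.mem_span_singleton_self b)
  -- If `a` or `b` lies in `U`, or both give the same point, no line is needed: the subspace is
  -- already `U + ⟨a⟩` or `U + ⟨b⟩`.
  by_cases haU : a ∈ U
  · have hbU : b ∉ U := fun hbU => hwU (hab ▸ U.add_mem haU hbU)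
    rw [heq (w i) b hwU hbU (hab ▸ Submodule.add_mem _ (le_sup_left (a := U) haU) (hmem b))]
    exact hind b hbU hb' hcb
  by_cases hbU : b ∈ U
  · rw [heq (w i) a hwU haU (hab ▸ Submodule.add_mem _ (hmem a) (le_sup_left (a := U) hbU))]
    exact hind a haU ha hca
  have hA := hind a haU ha hca
  have hB := hind b hbU hb' hcb
  by_cases hbA : b ∈ U ⊔ Submodule.span K {a}
  · rw [heq (w i) a hwU haU (hab ▸ Submodule.add_mem _ (hmem a) hbA)]
    exact hA
  refine hZ _ ⟨U, U ⊔ Submodule.span K {a} ⊔ Submodule.span K {b}, hU, ?_,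
    le_sup_left.trans le_sup_left, rfl⟩
    ((pencil_subset_schubertVariety hb i hU ha hb').trans
      (Set.subset_biUnion_of_mem (u := fun α => schubertVariety K α) hβ))
    _ ⟨?_, le_sup_left, le_sup_left⟩ hA
    _ ⟨?_, le_sup_left, sup_le (le_sup_left.trans le_sup_left) le_sup_right⟩ hB
    (fun hAB => hbA (hAB ▸ hmem b))
    ⟨?_, le_sup_left, sup_le (le_sup_left.trans le_sup_left)
      ((Submodule.span_singleton_le_iff_mem _ _).2 haddU)⟩
  · rw [Submodule.finrank_sup_span_singleton hbA, Submodule.finrank_sup_span_singleton haU, hU]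
  · exact (Submodule.finrank_sup_span_singleton haU).trans hU
  · exact (Submodule.finrank_sup_span_singleton hbU).trans hU
  · exact (Submodule.finrank_sup_span_singleton hwU).trans hU

theorem apartmentSubset_subset_schubertUnion {ℓ m : ℕ} (S : Set (Idx ℓ m)) :
    apartmentSubset K S ⊆ schubertUnion K S := by
  rintro _ ⟨β, hβ, rfl⟩
  exact Set.mem_biUnion hβ (coordSubspace_mem_schubertVariety β)

/-! ### From line-closed sets to the 2-closure -/

namespace BipartiteGraph

variable {P L : Type*} (G : BipartiteGraph P L)

theorem closure_subset {k : ℕ} {T : Set P} (hT : T ⊆ G.V₁) : G.closure k T ⊆ G.V₁ := by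
  refine G.subset_of_isOutput (G.closure_isOutput k T).1 hT ?_
  rintro _ ⟨u, -, -, hlt, -⟩
  -- No step starts from `V₁`, since it already contains every neighborhood.
  rw [Set.inter_eq_left.2 fun _ hv => hv.1] at hlt
  exact lt_irrefl _ hlt

theorem nbhd_subset_closure {k : ℕ} {T : Set P} {u : L} (hu : u ∈ G.V₂)
    (hk : k ≤ (G.nbhd u ∩ G.closure k T).ncard) : G.nbhd u ⊆ G.closure k T := by
  by_contra hsub
  exact (G.closure_isOutput k T).2 _ ⟨u, hu, hk, Set.ncard_lt_ncard
    ⟨Set.inter_subset_left, fun hle => hsub fun v hv => (hle hv).2⟩ (G.finite_nbhd u), rfl⟩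

end BipartiteGraph

theorem nbhd_incidenceGraph [Finite K] {ℓ m : ℕ} {X : Set (Submodule K (Fin m → K))}
    {Λ : Set (Submodule K (Fin m → K))} (hΛ : Λ ∈ lines K ℓ m) (hX : Λ ⊆ X) :
    (incidenceGraph K ℓ X).nbhd Λ = Λ :=
  Set.Subset.antisymm (fun _ hV => hV.2.2.2) fun _ hV => ⟨hX hV, hX hV, ⟨hΛ, hX⟩, hV⟩

theorem closure_apartmentSubset [Finite K] {ℓ m : ℕ} {S : Set (Idx ℓ m)}
    (hS : IsDownwardClosed S) :
    (incidenceGraph K ℓ (schubertUnion K S)).closure 2 (apartmentSubset K S) =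
      schubertUnion K S := by
  refine Set.Subset.antisymm
    (BipartiteGraph.closure_subset _ (apartmentSubset_subset_schubertUnion S)) ?_
  intro W hW
  obtain ⟨α, hα, hWα⟩ := Set.mem_iUnion₂.1 hW
  obtain ⟨hdim, w, rfl, hb⟩ := mem_schubertVariety_iff.1 hWα
  refine span_range_mem_of_lineClosed hS
    (BipartiteGraph.subset_of_reflTransGen _ (BipartiteGraph.closure_isOutput _ _ _).1)
    (fun Λ hΛ hX A hA hAZ B hB hBZ hne => ?_) hα w hdim hb
  have hnb := nbhd_incidenceGraph hΛ hX
  have := BipartiteGraph.nbhd_subset_closure (incidenceGraph K ℓ (schubertUnion K S)) (k := 2)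
    (T := apartmentSubset K S) (u := Λ) ⟨hΛ, hX⟩ ?_
  · rwa [hnb] at this
  · rw [hnb]
    refine (Set.ncard_pair hne).ge.trans ?_
    exact Set.ncard_le_ncard (Set.insert_subset ⟨hA, hAZ⟩ (Set.singleton_subset_iff.2 ⟨hB, hBZ⟩))
      (Set.toFinite _)

end SchubertUnion

theorem mainTheorem2 (K : Type*) [Field K] [Finite K] (ℓ m : ℕ)
    (S : Set (SchubertUnion.Idx ℓ m)) (hS : SchubertUnion.IsDownwardClosed S) :
    (SchubertUnion.incidenceGraph K ℓ (SchubertUnion.schubertUnion K S)).closure 2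
        (SchubertUnion.apartmentSubset K S) = SchubertUnion.schubertUnion K S ∧
      (SchubertUnion.incidenceGraph K ℓ (SchubertUnion.schubertUnion K S)).IsForcingSet 2
        (SchubertUnion.apartmentSubset K S) :=
  ⟨SchubertUnion.closure_apartmentSubset hS,
    SchubertUnion.apartmentSubset_subset_schubertUnion S,
    SchubertUnion.closure_apartmentSubset hS⟩
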